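/- Let $d\ge 0$ be an integer, let $\mathcal P(\mathbb R^d)$ be the set of Borel probability measures on $\mathbb R^d$ with the topology of weak convergence, $\mathcal P_2$ the set of those with finite second moment, and $\mathcal P_2^{ac}\subset\mathcal P_2$ the set of those that are moreover absolutely continuous with respect to Lebesgue measure. Let $$W_2(\mu,\nu)=\Big(\inf_{\pi}\int |x-y|^2\,\pi(dx,dy)\Big)^{1/2}\in[0,\infty],$$ the infimum being over all couplings $\pi$ of $\mu$ and $\nu$. Let $K\subset\mathcal P(\mathbb R^d)$ satisfy (H2): $K$ is closed for the weak topology and, for all $\mathbb R^d$-valued random vectors $X_0,X_1$ defined on a common probability space (with any joint law) whose laws belong to $K$, the law of $(1-\alpha)X_0+\alpha X_1$ belongs to $K$ for every $\alpha\in[0,1]$. Let $\mu,\nu\in\mathcal P_2^{ac}$ and let $X^\mu,X^\nu$ be arbitrary random vectors with laws $\mu$ and $\nu$, defined on one and the same (arbitrary) probability space $(\Omega,\mathcal F,\mathbb P)$. Let $X^{\mu^K}$ be a projection of $X^\mu$ on $K$, that is, a random vector on $(\Omega,\mathcal F,\mathbb P)$ such that * its law $\mu^K$ is a $W_2$-projection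 of $\mu$ on $K$: $\mu^K\in K\cap\mathcal P_2$ and $W_2(\mu,\mu^K)\le W_2(\mu,\rho)$ for all $\rho\in K$; * $\mathbb E\big[|X^\mu-X^{\mu^K}|^2\big]\le\mathbb E\big[|X^\mu-Y|^2\big]$ for every random vector $Y:\Omega\to\mathbb R^d$ whose law belongs to $K$. Let $X^{\nu^K}$ be, in the same sense, a projection of $X^\nu$ on $K$. Then the random variable $(X^\nu-X^\mu)\cdot\big((X^{\nu^K}-X^\nu)-(X^{\mu^K}-X^\mu)\big)$ is integrable and $$\mathbb E\Big[(X^\nu-X^\mu)\cdot\big((X^{\nu^K}-X^\nu)-(X^{\mu^K}-X^\mu)\big)\Big]\le 0.$$ -/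

import Mathlib

open MeasureTheory ProbabilityTheory
open scoped ENNReal

/-- Borel probability measures on `ℝ^d`; the topology Mathlib puts on this type is that of
weak convergence. -/
abbrev Prob (d : ℕ) : Type := ProbabilityMeasure (EuclideanSpace ℝ (Fin d))

/-- The probability measures on `ℝ^d` with finite second moment. -/
def P2 (d : ℕ) : Set (Prob d) :=
  {μ | ∫⁻ x, ‖x‖ₑ ^ 2 ∂(μ : Measure (EuclideanSpace ℝ (Fin d))) < ∞}

/-- The probability measures on `ℝ^d` with finite second moment that are absolutely continuous
with respect to Lebesgue measure. -/
def P2ac (d : ℕ) : Set (Prob d) :=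
  {μ | μ ∈ P2 d ∧ (μ : Measure (EuclideanSpace ℝ (Fin d))) ≪ volume}

/-- The law of the random vector `X` under `P` belongs to `K`. -/
def LawIn {d : ℕ} {Ω : Type*} [MeasurableSpace Ω] (K : Set (Prob d))
    (X : Ω → EuclideanSpace ℝ (Fin d)) (P : Measure Ω) : Prop :=
  ∃ ρ ∈ K, HasLaw X (ρ : Measure (EuclideanSpace ℝ (Fin d))) P

/-- The assumption on the constraint set: `K` is weakly closed, and for all random vectors
`X₀, X₁` with laws in `K`, on a common probability space and with an arbitrary joint law,
the law of `(1 - α) X₀ + α X₁` is in `K` for every `α ∈ [0, 1]`.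
(Only the joint law of `(X₀, X₁)` matters, so spaces `Ω : Type` already give every case.) -/
structure HypConstraint {d : ℕ} (K : Set (Prob d)) : Prop where
  isClosed : IsClosed K
  interpolation : ∀ (Ω : Type) [MeasurableSpace Ω] (P : Measure Ω) [IsProbabilityMeasure P]
    (X₀ X₁ : Ω → EuclideanSpace ℝ (Fin d)), LawIn K X₀ P → LawIn K X₁ P →
    ∀ α ∈ Set.Icc (0 : ℝ) 1, LawIn K (fun ω => (1 - α) • X₀ ω + α • X₁ ω) P

/-- The couplings of `μ` and `ν`. -/
def Couplings {d : ℕ} (μ ν : Prob d) :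
    Set (ProbabilityMeasure (EuclideanSpace ℝ (Fin d) × EuclideanSpace ℝ (Fin d))) :=
  {π | (π : Measure (EuclideanSpace ℝ (Fin d) × EuclideanSpace ℝ (Fin d))).map Prod.fst = μ ∧
    (π : Measure (EuclideanSpace ℝ (Fin d) × EuclideanSpace ℝ (Fin d))).map Prod.snd = ν}

/-- The quadratic Wasserstein distance, with values in `[0, ∞]`. -/
noncomputable def W2 {d : ℕ} (μ ν : Prob d) : ℝ≥0∞ :=
  (⨅ π ∈ Couplings μ ν,
    ∫⁻ p, ‖p.1 - p.2‖ₑ ^ 2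
      ∂(π : Measure (EuclideanSpace ℝ (Fin d) × EuclideanSpace ℝ (Fin d)))) ^ (1 / 2 : ℝ)

/-- `μK` is a `W₂`-projection of `μ` on `K`: an element of `K`, with finite second moment, that
minimizes `ν ↦ W₂(μ, ν)` over `K`. -/
structure IsKProjection {d : ℕ} (K : Set (Prob d)) (μ μK : Prob d) : Prop where
  mem : μK ∈ K
  mem_P2 : μK ∈ P2 d
  minimal : ∀ ν ∈ K, W2 μ μK ≤ W2 μ ν

/-- `XK` is a projection on `K` of the representant `X` of `μ`: its law is a `W₂`-projection of
`μ` on `K`, and `E|X - XK|² ≤ E|X - Y|²` for every random vector `Y` on the same probability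
space whose law is in `K`. -/
structure IsRepresentantProjection {d : ℕ} {Ω : Type*} [MeasurableSpace Ω] (K : Set (Prob d))
    (μ : Prob d) (P : Measure Ω) (X XK : Ω → EuclideanSpace ℝ (Fin d)) : Prop where
  law : ∃ μK : Prob d, IsKProjection K μ μK ∧
    HasLaw XK (μK : Measure (EuclideanSpace ℝ (Fin d))) P
  minimal : ∀ Y : Ω → EuclideanSpace ℝ (Fin d), LawIn K Y P →
    ∫⁻ ω, ‖X ω - XK ω‖ₑ ^ 2 ∂P ≤ ∫⁻ ω, ‖X ω - Y ω‖ₑ ^ 2 ∂P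

/-!
The result is a property of metric projections on convex sets in the Hilbert space `L²(P; ℝ^d)`.
The random vectors whose law lies in `K` form a convex set
(`HypConstraint.lawIn_interpolation`), on which `XμK` and `XνK` minimize the distance to `Xμ`
and `Xν`, so both satisfy the usual variational inequality
(`integral_inner_nonpos_of_interpolation_minimal`). With `D = Xν - Xμ` and `δ = XνK - XμK`, adding
the inequality at `XμK` tested against `XνK` to the one at `XνK` tested against `XμK` gives
`E⟪δ, δ - D⟫ ≤ 0`, and `⟪D, δ - D⟫ = ⟪δ, δ - D⟫ - ‖δ - D‖²` pointwise.
-/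

/-- The interpolation property of `K` on a probability space in any universe. -/
lemma HypConstraint.lawIn_interpolation {d : ℕ} {K : Set (Prob d)} (hK : HypConstraint K)
    {Ω : Type*} [MeasurableSpace Ω] {P : Measure Ω} [IsProbabilityMeasure P]
    {X Y : Ω → EuclideanSpace ℝ (Fin d)} (hX : LawIn K X P) (hY : LawIn K Y P)
    {α : ℝ} (hα : α ∈ Set.Icc (0 : ℝ) 1) :
    LawIn K (fun ω => (1 - α) • X ω + α • Y ω) P := by
  obtain ⟨ρ, hρ, hXρ⟩ := hX
  obtain ⟨σ, hσ, hYσ⟩ := hY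
  have hXY : AEMeasurable (fun ω => (X ω, Y ω)) P := hXρ.aemeasurable.prodMk hYσ.aemeasurable
  -- The joint law lives on a space in `Type`, where `hK.interpolation` applies.
  have : IsProbabilityMeasure (P.map fun ω => (X ω, Y ω)) := Measure.isProbabilityMeasure_map hXY
  have h₀ : LawIn K Prod.fst (P.map fun ω => (X ω, Y ω)) :=
    ⟨ρ, hρ, measurable_fst.aemeasurable, by
      rw [AEMeasurable.map_map_of_aemeasurable measurable_fst.aemeasurable hXY]
      exact hXρ.map_eq⟩
  have h₁ : LawIn K Prod.snd (P.map fun ω => (X ω, Y ω)) :=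
    ⟨σ, hσ, measurable_snd.aemeasurable, by
      rw [AEMeasurable.map_map_of_aemeasurable measurable_snd.aemeasurable hXY]
      exact hYσ.map_eq⟩
  obtain ⟨τ, hτ, h⟩ := hK.interpolation _ _ _ _ h₀ h₁ α hα
  exact ⟨τ, hτ, h.comp ⟨hXY, rfl⟩⟩

lemma memLp_two_of_hasLaw_mem_P2 {d : ℕ} {Ω : Type*} [MeasurableSpace Ω] {P : Measure Ω}
    {X : Ω → EuclideanSpace ℝ (Fin d)} {μ : Prob d} (hμ : μ ∈ P2 d)
    (hX : HasLaw X (μ : Measure (EuclideanSpace ℝ (Fin d))) P) : MemLp X 2 P := by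
  refine ⟨hX.aemeasurable.aestronglyMeasurable, ?_⟩
  rw [eLpNorm_lt_top_iff_lintegral_rpow_enorm_lt_top two_ne_zero ENNReal.ofNat_ne_top]
  have h : ∫⁻ x, ‖x‖ₑ ^ 2 ∂(P.map X) < ∞ := by
    rw [hX.map_eq]
    exact hμ
  rw [lintegral_map' (by fun_prop) hX.aemeasurable] at h
  simpa using h

section Projection

variable {Ω E : Type*} [MeasurableSpace Ω] {P : Measure Ω}
  [NormedAddCommGroup E]

lemma MeasureTheory.MemLp.lintegral_enorm_sq_eq_ofReal {f : Ω → E} (hf : MemLp f 2 P) :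
    ∫⁻ ω, ‖f ω‖ₑ ^ 2 ∂P = ENNReal.ofReal (∫ ω, ‖f ω‖ ^ 2 ∂P) := by
  rw [ofReal_integral_eq_lintegral_ofReal (hf.integrable_norm_pow two_ne_zero)
    (Filter.Eventually.of_forall fun _ => by positivity)]
  refine lintegral_congr fun ω => ?_
  rw [ENNReal.ofReal_pow (norm_nonneg _), ofReal_norm]

variable [InnerProductSpace ℝ E]

lemma MeasureTheory.MemLp.integrable_real_inner {f g : Ω → E} (hf : MemLp f 2 P)
    (hg : MemLp g 2 P) : Integrable (fun ω => inner ℝ (f ω) (g ω)) P :=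
  (hf.norm.integrable_mul hg.norm).mono (hf.1.inner hg.1) <| .of_forall fun ω => by
    simpa using norm_inner_le_norm (𝕜 := ℝ) (f ω) (g ω)

/-- The variational inequality for metric projections in `L²`: if no point of the segment from `Z`
to `Y` is closer to `X` than `Z` is, then `X - Z` and `Y - Z` make an obtuse angle. -/
lemma integral_inner_nonpos_of_interpolation_minimal {X Z Y : Ω → E}
    (hX : MemLp X 2 P) (hZ : MemLp Z 2 P) (hY : MemLp Y 2 P)
    (hmin : ∀ α ∈ Set.Icc (0 : ℝ) 1, ∫⁻ ω, ‖X ω - Z ω‖ₑ ^ 2 ∂P ≤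
      ∫⁻ ω, ‖X ω - ((1 - α) • Z ω + α • Y ω)‖ₑ ^ 2 ∂P) :
    ∫ ω, inner ℝ (X ω - Z ω) (Y ω - Z ω) ∂P ≤ 0 := by
  have hu : MemLp (fun ω => X ω - Z ω) 2 P := hX.sub hZ
  have hv : MemLp (fun ω => Y ω - Z ω) 2 P := hY.sub hZ
  have hu2 := hu.integrable_norm_pow two_ne_zero
  have hv2 := hv.integrable_norm_pow two_ne_zero
  have huv : Integrable (fun ω => inner ℝ (X ω - Z ω) (Y ω - Z ω)) P := hu.integrable_real_inner hv
  set c := ∫ ω, inner ℝ (X ω - Z ω) (Y ω - Z ω) ∂P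
  set q := ∫ ω, ‖Y ω - Z ω‖ ^ 2 ∂P
  have key : ∀ α ∈ Set.Icc (0 : ℝ) 1, 2 * α * c ≤ α ^ 2 * q := by
    intro α hα
    have h := hmin α hα
    have heq : (fun ω => X ω - ((1 - α) • Z ω + α • Y ω)) =
        fun ω => (X ω - Z ω) - α • (Y ω - Z ω) := by
      funext ω
      module
    have hw : MemLp (fun ω => X ω - ((1 - α) • Z ω + α • Y ω)) 2 P := by
      rw [heq]
      exact hu.sub (hv.const_smul α)
    rw [hu.lintegral_enorm_sq_eq_ofReal, hw.lintegral_enorm_sq_eq_ofReal,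
      ENNReal.ofReal_le_ofReal_iff (integral_nonneg fun _ => by positivity)] at h
    have hexp : ∀ ω, ‖X ω - ((1 - α) • Z ω + α • Y ω)‖ ^ 2 =
        ‖X ω - Z ω‖ ^ 2 - 2 * α * inner ℝ (X ω - Z ω) (Y ω - Z ω) + α ^ 2 * ‖Y ω - Z ω‖ ^ 2 := by
      intro ω
      rw [congrFun heq ω, norm_sub_sq_real, inner_smul_right, norm_smul, mul_pow,
        Real.norm_eq_abs, sq_abs]
      ring
    simp_rw [hexp] at h
    rw [integral_add (f := fun ω => ‖X ω - Z ω‖ ^ 2 - 2 * α * inner ℝ (X ω - Z ω) (Y ω - Z ω))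
        (hu2.sub (huv.const_mul _)) (hv2.const_mul _), integral_sub hu2 (huv.const_mul _), integral_const_mul, integral_const_mul] at h
    linarith
  have hq : 0 ≤ q := integral_nonneg fun _ => by positivity
  by_contra! hc
  -- `α = c / (c + q)` lies in `(0, 1]` and satisfies `α * q < c`.
  have hα : 0 < c / (c + q) := by positivity
  have h := key _ ⟨hα.le, (div_le_one (by positivity)).2 (by linarith)⟩
  have hαq : c / (c + q) * (c + q) = c := div_mul_cancel₀ _ (by positivity)
  nlinarith [mul_pos hα hc]

end Projection

theorem corollary2p4 {d : ℕ} (K : Set (Prob d)) (hK : HypConstraint K)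
    (μ ν : Prob d) (hμ : μ ∈ P2ac d) (hν : ν ∈ P2ac d)
    {Ω : Type*} [MeasurableSpace Ω] (P : Measure Ω) [IsProbabilityMeasure P]
    (Xμ Xν XμK XνK : Ω → EuclideanSpace ℝ (Fin d))
    (hXμ : HasLaw Xμ (μ : Measure (EuclideanSpace ℝ (Fin d))) P)
    (hXν : HasLaw Xν (ν : Measure (EuclideanSpace ℝ (Fin d))) P)
    (hXμK : IsRepresentantProjection K μ P Xμ XμK)
    (hXνK : IsRepresentantProjection K ν P Xν XνK) :
    Integrable (fun ω => inner ℝ (Xν ω - Xμ ω) ((XνK ω - Xν ω) - (XμK ω - Xμ ω))) P ∧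
      ∫ ω, inner ℝ (Xν ω - Xμ ω) ((XνK ω - Xν ω) - (XμK ω - Xμ ω)) ∂P ≤ 0 := by
  have hA := memLp_two_of_hasLaw_mem_P2 hμ.1 hXμ
  have hB := memLp_two_of_hasLaw_mem_P2 hν.1 hXν
  obtain ⟨⟨μK, hμK, hlμ⟩, hmμ⟩ := hXμK
  obtain ⟨⟨νK, hνK, hlν⟩, hmν⟩ := hXνK
  have ha := memLp_two_of_hasLaw_mem_P2 hμK.mem_P2 hlμ
  have hb := memLp_two_of_hasLaw_mem_P2 hνK.mem_P2 hlν
  have hKμ : LawIn K XμK P := ⟨μK, hμK.mem, hlμ⟩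
  have hKν : LawIn K XνK P := ⟨νK, hνK.mem, hlν⟩
  have h₁ := integral_inner_nonpos_of_interpolation_minimal hA ha hb
    fun α hα => hmμ _ (hK.lawIn_interpolation hKμ hKν hα)
  have h₂ := integral_inner_nonpos_of_interpolation_minimal hB hb ha
    fun α hα => hmν _ (hK.lawIn_interpolation hKν hKμ hα)
  have hi₁ : Integrable (fun ω => inner ℝ (Xμ ω - XμK ω) (XνK ω - XμK ω)) P :=
    (hA.sub ha).integrable_real_inner (hb.sub ha)
  have hi₂ : Integrable (fun ω => inner ℝ (Xν ω - XνK ω) (XμK ω - XνK ω)) P :=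
    (hB.sub hb).integrable_real_inner (ha.sub hb)
  have hi : Integrable (fun ω => inner ℝ (Xν ω - Xμ ω) ((XνK ω - Xν ω) - (XμK ω - Xμ ω))) P :=
    (hB.sub hA).integrable_real_inner ((hb.sub hB).sub (ha.sub hA))
  refine ⟨hi, (integral_mono hi (hi₁.add hi₂) fun ω => ?_).trans ?_⟩
  · have h := real_inner_self_nonneg (x := (XνK ω - Xν ω) - (XμK ω - Xμ ω))
    simp only [Pi.add_apply, inner_sub_left, inner_sub_right] at h ⊢
    linarith [real_inner_comm (Xν ω) (Xμ ω), real_inner_comm (XνK ω) (XμK ω),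
      real_inner_comm (Xν ω) (XνK ω), real_inner_comm (Xμ ω) (XμK ω),
      real_inner_comm (Xν ω) (XμK ω), real_inner_comm (Xμ ω) (XνK ω)]
  · rw [integral_add' hi₁ hi₂]
    linarith
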